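/- Let $\kappa:\mathbb R^d\times\mathbb R^d\to\mathbb R$ be a continuous, bounded, translation-invariant positive semidefinite kernel with reproducing kernel Hilbert space $\mathcal H$, normalized so that its spectral measure $\Lambda$ is a probability measure, i.e. $\kappa(u,v)=\int \exp(i\,w^\top(u-v))\,d\Lambda(w)$. Assume that for some $S,R>0$ $$\mathbb E_{w\sim\Lambda}\big[|w_i|^{2k}\big]\le \frac{k!\,S^2R^{k-2}}{2}\qquad\text{for all } 1\le i\le d,\ k\ge 2,$$ and put $L:=\big\|\mathbb E_{w\sim\Lambda}[ww^\top]\big\|_2^{1/2}$ (spectral norm). Let $m\ge 1$ and let $\mathbf x=(x_1,\dots,x_{\ell_{\mathbf x}})$, $\mathbf y=(y_1,\dots,y_{\ell_{\mathbf y}})$ be finite non-empty sequences in $\mathbb R^d$, with $\|\mathbf x\|_{1\text{-var}}:=\sum_{i<\ell_{\mathbf x}}\|x_{i+1}-x_i\|_2$. For a feature map $\varphi$ write $\delta\varphi(x_i)=\varphi(x_{i+1})-\varphi(x_i)$. The level-$m$ signature kernel is $$k_{\mathrm{Sig}}(\mathbf x,\mathbf y)=\Big\langle \sum_{1\le i_1<\dots<i_m<\ell_{\mathbf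 x}}\delta\kappa_{x_{i_1}}\otimes\dots\otimes\delta\kappa_{x_{i_m}},\ \sum_{1\le j_1<\dots<j_m<\ell_{\mathbf y}}\delta\kappa_{y_{j_1}}\otimes\dots\otimes\delta\kappa_{y_{j_m}}\Big\rangle_{\mathcal H^{\otimes m}},\qquad \kappa_u=\kappa(u,\cdot).$$ For $\tilde d\ge 1$ let $w^{(p)}_q$ ($1\le p\le m$, $1\le q\le\tilde d$) be i.i.d. with law $\Lambda$, let $\hat\varphi_{p,q}(u)=\big(\cos({w_q^{(p)}}^{\top}u),\sin({w_q^{(p)}}^{\top}u)\big)\in\mathbb R^2$, and let $$k_{\mathrm{DP}}(\mathbf x,\mathbf y)=\frac1{\tilde d}\sum_{q=1}^{\tilde d}\Big\langle \sum_{i_1<\dots<i_m}\delta\hat\varphi_{1,q}(x_{i_1})\otimes\dots\otimes\delta\hat\varphi_{m,q}(x_{i_m}),\ \sum_{j_1<\dots<j_m}\delta\hat\varphi_{1,q}(y_{j_1})\otimes\dots\otimes\delta\hat\varphi_{m,q}(y_{j_m})\Big\rangle_{(\mathbb R^2)^{\otimes m}}$$ be the level-$m$ diagonally projected random Fourier signature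 kernel (RFSF-DP). Then $\kappa$ is $L$-Lipschitz, i.e. $\|\kappa_u-\kappa_v\|_{\mathcal H}\le L\|u-v\|_2$ for all $u,v$. If $\|\mathbf x\|_{1\text{-var}},\|\mathbf y\|_{1\text{-var}}>0$, there is a constant $C>0$, not depending on $\tilde d$, $\epsilon$ or the probability space, with $$C\le \sqrt8\,e^4(2\pi)^{1/4}e^{1/24}\Big(\frac{4e^3\|\mathbf x\|_{1\text{-var}}\|\mathbf y\|_{1\text{-var}}}{m}\Big)^m\Big(\big(2d\max(S,R)\big)^m+\big(L^2/\ln 2\big)^m\Big),$$ such that for every $\tilde d\ge1$ and every $\epsilon>0$ $$\mathbb P\big[|k_{\mathrm{DP}}(\mathbf x,\mathbf y)-k_{\mathrm{Sig}}(\mathbf x,\mathbf y)|\ge\epsilon\big]\le 2\exp\left(-\frac14\min\left\{\Big(\frac{\sqrt{\tilde d}\,\epsilon}{2C}\Big)^2,\ \Big(\frac{\tilde d\,\epsilon}{\sqrt8\,C}\Big)^{1/m}\right\}\right).$$ If $\|\mathbf x\|_{1\text{-var}}=0$ or $\|\mathbf y\|_{1\text{-var}}=0$, then $k_{\mathrm{DP}}(\mathbf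 x,\mathbf y)=k_{\mathrm{Sig}}(\mathbf x,\mathbf y)$ surely. -/

import Mathlib

open MeasureTheory ProbabilityTheory
open scoped TensorProduct

/-- A real inner product space, bundled with its structure. -/
structure RealInnerSpace : Type 1 where
  /-- the underlying type -/
  carrier : Type
  [normed : NormedAddCommGroup carrier]
  [innerProduct : InnerProductSpace ℝ carrier]

attribute [instance] RealInnerSpace.normed RealInnerSpace.innerProduct

/-- The algebraic tensor power `H ⊗ ⋯ ⊗ H` (`m` factors) with its inner product. The
topological completion is not needed: all tensors below are finite sums of elementary ones. -/
noncomputable def hilbertPower (H : Type) [NormedAddCommGroup H] [InnerProductSpace ℝ H] :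
    ℕ → RealInnerSpace
  | 0 => ⟨ℝ⟩
  | m + 1 => ⟨(hilbertPower H m).carrier ⊗[ℝ] H⟩

/-- The elementary tensor `h 0 ⊗ ⋯ ⊗ h (m - 1)`. -/
noncomputable def elementaryTensor {H : Type} [NormedAddCommGroup H] [InnerProductSpace ℝ H] :
    (m : ℕ) → (Fin m → H) → (hilbertPower H m).carrier
  | 0, _ => (1 : ℝ)
  | m + 1, h => elementaryTensor m (fun p => h p.castSucc) ⊗ₜ[ℝ] h (Fin.last m)

/-- The inner product of elementary tensors is the product of the inner products. -/
theorem inner_elementaryTensor {H : Type} [NormedAddCommGroup H] [InnerProductSpace ℝ H]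
    (m : ℕ) (h f : Fin m → H) :
    inner ℝ (elementaryTensor m h) (elementaryTensor m f) = ∏ p, inner ℝ (h p) (f p) := by
  induction m with
  | zero =>
    change inner ℝ (1 : ℝ) (1 : ℝ) = _
    simp
  | succ m ih =>
    rw [Fin.prod_univ_castSucc, ← ih]
    exact TensorProduct.inner_tmul (𝕜 := ℝ) (E := (hilbertPower H m).carrier) (F := H)
      (elementaryTensor m fun p => h p.castSucc) (elementaryTensor m fun p => f p.castSucc)
      (h (Fin.last m)) (f (Fin.last m))

/-- The strictly increasing `m`-tuples of indices of `n` increments. -/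
noncomputable def increasingTuples (m n : ℕ) : Finset (Fin m → Fin n) :=
  open scoped Classical in Finset.univ.filter fun i => StrictMono i

/-- The `1`-variation of a sequence `x` of length `n + 1`. -/
noncomputable def oneVar {d n : ℕ} (x : Fin (n + 1) → EuclideanSpace ℝ (Fin d)) : ℝ :=
  ∑ i : Fin n, ‖x i.succ - x i.castSucc‖

/-- The level-`m` tensor
`∑_{i_1 < ⋯ < i_m} δφ_1(x_{i_1}) ⊗ ⋯ ⊗ δφ_m(x_{i_m})` of a sequence `x` of length `n + 1`, where
the feature map `φ p` is used in the tensor factor `p` and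
`δφ(x_i) = φ(x_{i + 1}) - φ(x_i)`. -/
noncomputable def levelFeature {d m n : ℕ} {H : Type} [NormedAddCommGroup H]
    [InnerProductSpace ℝ H] (φ : Fin m → EuclideanSpace ℝ (Fin d) → H)
    (x : Fin (n + 1) → EuclideanSpace ℝ (Fin d)) : (hilbertPower H m).carrier :=
  ∑ i ∈ increasingTuples m n,
    elementaryTensor m fun p => φ p (x (i p).succ) - φ p (x (i p).castSucc)

/-- The function `κ_u = κ(u, ·)`, as an element of the reproducing kernel Hilbert space `H`
with kernel `κ`. -/
noncomputable def kernelLift {d : ℕ} (H : Type) [NormedAddCommGroup H] [InnerProductSpace ℝ H]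
    [CompleteSpace H] [RKHS ℝ H (EuclideanSpace ℝ (Fin d)) ℝ]
    (u : EuclideanSpace ℝ (Fin d)) : H :=
  RKHS.kerFun H u (1 : ℝ)

/-- The level-`m` signature kernel of two sequences, built from the reproducing kernel lift
into `H`. -/
noncomputable def sigKernel {d n₁ n₂ : ℕ} (H : Type) [NormedAddCommGroup H]
    [InnerProductSpace ℝ H] [CompleteSpace H] [RKHS ℝ H (EuclideanSpace ℝ (Fin d)) ℝ] (m : ℕ)
    (x : Fin (n₁ + 1) → EuclideanSpace ℝ (Fin d))
    (y : Fin (n₂ + 1) → EuclideanSpace ℝ (Fin d)) : ℝ :=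
  inner ℝ (levelFeature (fun _ : Fin m => kernelLift H) x)
    (levelFeature (fun _ : Fin m => kernelLift H) y)

/-- The random Fourier feature map of sample size one with weight `w`. -/
noncomputable def fourierFeature {d : ℕ} (w u : EuclideanSpace ℝ (Fin d)) :
    EuclideanSpace ℝ (Fin 2) :=
  !₂[Real.cos (inner ℝ w u), Real.sin (inner ℝ w u)]

/-- The level-`m` diagonally projected random Fourier signature feature of a sequence, with
weights `W p q` for the tensor factor `p` of the `q`-th block. -/
noncomputable def dpFeature {d m D n : ℕ} (W : Fin m → Fin D → EuclideanSpace ℝ (Fin d))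
    (x : Fin (n + 1) → EuclideanSpace ℝ (Fin d)) :
    PiLp 2 fun _ : Fin D => (hilbertPower (EuclideanSpace ℝ (Fin 2)) m).carrier :=
  (1 / √(D : ℝ)) •
    WithLp.toLp 2 fun q : Fin D => levelFeature (fun p : Fin m => fourierFeature (W p q)) x

/-- The level-`m` RFSF-DP kernel with weights `W`. -/
noncomputable def dpKernel {d m D n₁ n₂ : ℕ} (W : Fin m → Fin D → EuclideanSpace ℝ (Fin d))
    (x : Fin (n₁ + 1) → EuclideanSpace ℝ (Fin d))
    (y : Fin (n₂ + 1) → EuclideanSpace ℝ (Fin d)) : ℝ :=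
  inner ℝ (dpFeature W x) (dpFeature W y)

/-- `Λ` is the spectral measure of `κ`: `κ(u, v) = ∫ exp(i wᵀ(u - v)) dΛ(w)`. For a probability
measure `Λ` this makes `κ` continuous, bounded and translation-invariant. -/
def IsSpectralMeasure {d : ℕ} (κ : EuclideanSpace ℝ (Fin d) → EuclideanSpace ℝ (Fin d) → ℝ)
    (Λ : Measure (EuclideanSpace ℝ (Fin d))) : Prop :=
  ∀ u v, (κ u v : ℂ) = ∫ w, Complex.exp (Complex.I * ((inner ℝ w (u - v) : ℝ) : ℂ)) ∂Λ

/-- The Bernstein condition on the even moments of the coordinates under `Λ`. -/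
def BernsteinMoments {d : ℕ} (Λ : Measure (EuclideanSpace ℝ (Fin d))) (S R : ℝ) : Prop :=
  ∀ i : Fin d, ∀ k : ℕ, 2 ≤ k →
    Integrable (fun w => |w i| ^ (2 * k)) Λ ∧
      ∫ w, |w i| ^ (2 * k) ∂Λ ≤ (k.factorial : ℝ) * S ^ 2 * R ^ (k - 2) / 2

/-- The second moment matrix `E[w wᵀ]`. -/
noncomputable def secondMomentMatrix {d : ℕ} (Λ : Measure (EuclideanSpace ℝ (Fin d))) :
    Matrix (Fin d) (Fin d) ℝ :=
  Matrix.of fun i j => ∫ w, w i * w j ∂Λ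

/-- The Lipschitz constant `‖E[w wᵀ]‖₂^{1/2}`, with the spectral norm. -/
noncomputable def spectralLipschitz {d : ℕ} (Λ : Measure (EuclideanSpace ℝ (Fin d))) : ℝ :=
  √‖Matrix.toEuclideanCLM (n := Fin d) (𝕜 := ℝ) (secondMomentMatrix Λ)‖

/-- The explicit bound
`√8 e⁴ (2π)^{1/4} e^{1/24} (4 e³ V₁ V₂ / m)^m ((2 d max(S, R))^m + (L² / ln 2)^m)`. -/
noncomputable def dpConstant (d m : ℕ) (V₁ V₂ S R L : ℝ) : ℝ :=
  √8 * Real.exp 4 * (2 * Real.pi) ^ (1 / 4 : ℝ) * Real.exp (1 / 24) *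
    (4 * Real.exp 3 * V₁ * V₂ / m) ^ m * ((2 * d * max S R) ^ m + (L ^ 2 / Real.log 2) ^ m)

/-!
The RFSF-DP kernel is the average of `D` independent copies of the random variable
`fourierSigKernel x y w`, where `w` consists of `m` independent weights with law `Λ`. Since
`⟨φ_w(u), φ_w(v)⟩ = cos (wᵀ(u - v))` for the Fourier feature `φ_w`, each of its factors has mean
`⟨κ_u - κ_u', κ_v - κ_v'⟩`, and by independence of the `m` weights its mean is the signature kernel
(`integral_fourierSigKernel`). The same identity gives
`‖κ_u - κ_v‖² = 2 E[1 - cos (wᵀ(u - v))] ≤ E[(wᵀ(u - v))²]`, which is the Lipschitz bound.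

The map `u ↦ φ_w(u)` is `‖w‖`-Lipschitz, and a sum over increasing `m`-tuples is at most `1 / m!`
times the sum over all of them, so one copy is bounded by
`(‖x‖ ‖y‖)^m / (m!)² * ∏ p, ‖w p‖²`. The Bernstein condition bounds the `j`-th moment of `‖w‖²` by
`j! (d max(S, R))^j`. Hence the centred copies have `j`-th moments at most `B^j (j!)^m`
(`integral_abs_fourierSigKernel_sub_pow_le`), with `B` far below `dpConstant`
(`two_pow_mul_le_dpConstant`); the constant `C` of the theorem is `dpConstant` itself.

For independent centred variables with such moments, the tail bound
(`measureReal_abs_sum_ge_le`) comes from Markov's inequality for a single even moment of order `K`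
close to `t / 4`, where `t` is the minimum in the exponent. As for exponential moments, the
truncated exponential generating function of the moments is submultiplicative under independent
sums (`abs_integral_sum_pow_le`). With its argument
scaled to `ζ / B`, the quadratic term in `ζ` gives the Gaussian regime, and the restriction
`K ^ (m - 1) * ζ ≤ 1 / 2` under which that term dominates gives the regime with exponent `1 / m`.
-/

/-! ### Sums of independent variables with factorially growing moments -/

lemma memLp_of_integrable_abs_pow {Ω : Type*} [MeasurableSpace Ω] {P : Measure Ω}
    {f : Ω → ℝ} (hf : AEStronglyMeasurable f P) {n : ℕ} (hn : n ≠ 0)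
    (hi : Integrable (fun ω => |f ω| ^ n) P) : MemLp f n P := by
  rw [← integrable_norm_rpow_iff hf (by exact_mod_cast hn) (by simp)]
  simpa using hi

/-- Moments of a sum of independent variables, from the generating function
`G = ∑ i ≤ K, b i * z ^ i / i!` of moment bounds of the summands: the truncation at `K` replaces
the exponential moments, which need not exist here. By the binomial theorem, adding a summand
costs a factor `G`. -/
theorem abs_integral_sum_pow_le {Ω ι : Type*} [MeasurableSpace Ω] {P : Measure Ω}
    [IsProbabilityMeasure P] {Z : ι → Ω → ℝ} (hindep : iIndepFun Z P)
    (hmeas : ∀ i, Measurable (Z i)) (hint : ∀ i, ∀ j : ℕ, MemLp (Z i) j P)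
    {b : ℕ → ℝ} {K : ℕ} (hb : ∀ i, ∀ j ≤ K, |∫ ω, Z i ω ^ j ∂P| ≤ b j)
    {z : ℝ} (hz : 0 < z) (s : Finset ι) :
    ∀ j ≤ K, |∫ ω, (∑ i ∈ s, Z i ω) ^ j ∂P| ≤
      j.factorial * z⁻¹ ^ j *
        (∑ i ∈ Finset.range (K + 1), b i * z ^ i / i.factorial) ^ s.card := by
  classical
  have powInt {f : Ω → ℝ} {j : ℕ} (h : MemLp f j P) : Integrable (fun ω => f ω ^ j) P := by
    refine (integrable_norm_iff (by have := h.1; fun_prop)).1 ?_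
    simpa [norm_pow] using h.integrable_norm_pow'
  set G := ∑ i ∈ Finset.range (K + 1), b i * z ^ i / i.factorial with hG
  induction s using Finset.induction_on with
  | empty =>
    intro j _
    rcases Nat.eq_zero_or_pos j with rfl | hj
    · simp
    · simp [hj.ne']
      positivity
  | insert i₀ s hi₀ ih =>
    intro j hj
    have hind : IndepFun (fun ω => ∑ i ∈ s, Z i ω) (Z i₀) P := by
      have := hindep.indepFun_finsetSum_of_notMem hmeas hi₀
      convert this using 1
      ext ω; simp
    have hS : ∀ k : ℕ, MemLp (fun ω => ∑ i ∈ s, Z i ω) k P := fun k =>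
      memLp_finsetSum s fun i _ => hint i k
    have hb0 : ∀ k ≤ K, 0 ≤ b k := fun k hk => (abs_nonneg _).trans (hb i₀ k hk)
    have hG0 : 0 ≤ G := Finset.sum_nonneg fun i hi => by
      have := hb0 i (by simpa [Nat.lt_succ_iff] using hi)
      positivity
    have hindk (k l : ℕ) : IndepFun (fun ω => (∑ i ∈ s, Z i ω) ^ k) (fun ω => Z i₀ ω ^ l) P :=
      hind.comp (φ := fun x => x ^ k) (ψ := fun x => x ^ l) (by fun_prop) (by fun_prop)
    have hexp : ∫ ω, (∑ i ∈ insert i₀ s, Z i ω) ^ j ∂P =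
        ∑ k ∈ Finset.range (j + 1), (∫ ω, Z i₀ ω ^ k ∂P) *
          (∫ ω, (∑ i ∈ s, Z i ω) ^ (j - k) ∂P) * j.choose k := by
      simp_rw [Finset.sum_insert hi₀, add_pow]
      rw [integral_finsetSum]
      · refine Finset.sum_congr rfl fun k _ => ?_
        rw [integral_mul_const, ← (hindk (j - k) k).symm.integral_fun_mul_eq_mul_integral]
        · exact (powInt (hint i₀ k)).1
        · exact (powInt (hS (j - k))).1
      · intro k _
        exact ((hindk (j - k) k).symm.integrable_mul (powInt (hint i₀ k))
          (powInt (hS (j - k)))).mul_const _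
    rw [hexp, Finset.card_insert_of_notMem hi₀]
    calc _ ≤ ∑ k ∈ Finset.range (j + 1), b k *
          ((j - k).factorial * z⁻¹ ^ (j - k) * G ^ s.card) * j.choose k := by
          refine (Finset.abs_sum_le_sum_abs _ _).trans (Finset.sum_le_sum fun k hk => ?_)
          have hk' : k ≤ j := by simpa [Nat.lt_succ_iff] using hk
          rw [abs_mul, abs_mul, Nat.abs_cast]
          have := hb0 k (hk'.trans hj)
          gcongr
          · exact hb i₀ k (hk'.trans hj)
          · exact ih (j - k) (by omega)
      _ = j.factorial * z⁻¹ ^ j * G ^ s.card *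
          ∑ k ∈ Finset.range (j + 1), b k * z ^ k / k.factorial := by
          rw [Finset.mul_sum]
          refine Finset.sum_congr rfl fun k hk => ?_
          have hk' : k ≤ j := by simpa [Nat.lt_succ_iff] using hk
          have h1 : (j.choose k : ℝ) * k.factorial * (j - k).factorial = j.factorial := by
            exact_mod_cast Nat.choose_mul_factorial_mul_factorial hk'
          have h2 : z⁻¹ ^ j = z⁻¹ ^ (j - k) * z⁻¹ ^ k := by rw [← pow_add]; congr 1; omega
          rw [← h1, h2, inv_pow z k]
          field_simp
      _ ≤ j.factorial * z⁻¹ ^ j * G ^ s.card * G := by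
          gcongr
          rw [hG]
          refine Finset.sum_le_sum_of_subset_of_nonneg
            (Finset.range_mono (by omega)) fun i hi _ => ?_
          have := hb0 i (by simpa [Nat.lt_succ_iff] using hi)
          positivity
      _ = _ := by rw [pow_succ]; ring

/-- A factorial is at most `2 K ^ (i - 2)`: all its factors but `1` and `2` are at most `K`. -/
lemma factorial_add_two_le {K i : ℕ} (h : i + 2 ≤ K) : (i + 2).factorial ≤ 2 * K ^ i := by
  induction i with
  | zero => simp [Nat.factorial]
  | succ i ih =>
    rw [show i + 1 + 2 = (i + 2) + 1 by ring, Nat.factorial_succ]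
    calc _ ≤ K * (2 * K ^ i) := Nat.mul_le_mul (by omega) (ih (by omega))
      _ = _ := by ring

/-- For `ζ` so small that `K ^ r * ζ ≤ 1 / 2`, the terms up to the order `K` decay geometrically
from the quadratic one on; the whole series diverges if `r ≥ 1`. -/
theorem sum_factorial_pow_mul_pow_le {K r : ℕ} {ζ : ℝ} (hζ : 0 ≤ ζ)
    (h : (K : ℝ) ^ r * ζ ≤ 1 / 2) :
    ∑ i ∈ Finset.range (K - 1), ((i + 2).factorial : ℝ) ^ r * ζ ^ (i + 2) ≤
      2 ^ (r + 1) * ζ ^ 2 := by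
  calc _ ≤ ∑ i ∈ Finset.range (K - 1), 2 ^ r * ζ ^ 2 * (1 / 2 : ℝ) ^ i := by
        refine Finset.sum_le_sum fun i hi => ?_
        have hi' : i + 2 ≤ K := by have := Finset.mem_range.1 hi; omega
        calc ((i + 2).factorial : ℝ) ^ r * ζ ^ (i + 2)
            ≤ (2 * (K : ℝ) ^ i) ^ r * ζ ^ (i + 2) := by
              gcongr; exact_mod_cast factorial_add_two_le hi'
          _ = 2 ^ r * ζ ^ 2 * ((K : ℝ) ^ r * ζ) ^ i := by ring
          _ ≤ _ := by gcongr
    _ ≤ 2 ^ r * ζ ^ 2 * 2 := by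
        rw [← Finset.mul_sum]
        gcongr
        exact sum_geometric_two_le _
    _ = _ := by ring

/-- An admissible order `K` of the moment in Markov's inequality: even, at most `t`, and with
`exp (-K) ≤ exp (-t / 4)`. -/
lemma exists_even_natCast_between {t : ℝ} (ht : 8 / 3 ≤ t) :
    ∃ K : ℕ, Even K ∧ 2 ≤ K ∧ (K : ℝ) ≤ t ∧ t / 4 ≤ K := by
  refine ⟨2 * ⌈t / 8⌉₊, even_two_mul _, ?_, ?_, ?_⟩
  · have : 0 < ⌈t / 8⌉₊ := Nat.ceil_pos.2 (by linarith)
    omega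
  · have := Nat.ceil_lt_add_one (show 0 ≤ t / 8 by linarith)
    push_cast; linarith
  · have := Nat.le_ceil (t / 8)
    push_cast; linarith

/-- Two-regime tail bound for a sum of independent centred variables whose `j`-th moments grow like
`B ^ j * (j!) ^ (r + 1)`. -/
theorem measureReal_abs_sum_ge_le {Ω ι : Type*} [MeasurableSpace Ω] {P : Measure Ω}
    [IsProbabilityMeasure P] [Fintype ι] {Z : ι → Ω → ℝ} (hindep : iIndepFun Z P)
    (hmeas : ∀ i, Measurable (Z i)) (hint : ∀ i, ∀ j : ℕ, MemLp (Z i) j P)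
    (hmean : ∀ i, ∫ ω, Z i ω ∂P = 0) {B : ℝ} (hB : 0 < B) {r : ℕ}
    (hmom : ∀ i, ∀ j : ℕ, 2 ≤ j → |∫ ω, Z i ω ^ j ∂P| ≤ B ^ j * (j.factorial : ℝ) ^ (r + 1))
    {s t : ℝ} (hs : 0 < s)
    (h₁ : Fintype.card ι * 2 ^ (r + 1) * t * (Real.exp 2 * B) ^ 2 ≤ s ^ 2)
    (h₂ : 2 * t ^ (r + 1) * (Real.exp 2 * B) ≤ s) :
    P.real {ω | s ≤ |∑ i, Z i ω|} ≤ 2 * Real.exp (-(1 / 4) * t) := by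
  -- For `t ≤ 4 log 2` the right-hand side is at least `1`, and `8 / 3 < 4 log 2`.
  rcases lt_or_ge t (8 / 3) with ht | ht
  · have hlog := Real.log_two_gt_d9
    have : Real.exp (-Real.log 2) ≤ Real.exp (-(1 / 4) * t) := Real.exp_le_exp.2 (by linarith)
    rw [Real.exp_neg, Real.exp_log two_pos] at this
    linarith [measureReal_le_one (μ := P) (s := {ω | s ≤ |∑ i, Z i ω|})]
  obtain ⟨K, hKe, hK2, hKt, htK⟩ := exists_even_natCast_between ht
  have hK0 : (0 : ℝ) < K := by exact_mod_cast (by omega : 0 < K)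
  set E := Real.exp 2 * B with hE
  have hE0 : 0 < E := by positivity
  -- This `ζ` turns Markov's bound for the `K`-th moment into exactly `exp (-K)`.
  set ζ := K * E / s with hζdef
  have hζ : 0 < ζ := by positivity
  set z := ζ / B with hzdef
  have hz : 0 < z := by positivity
  have hζ1 : (K : ℝ) ^ r * ζ ≤ 1 / 2 := by
    rw [hζdef, ← mul_div_assoc, div_le_iff₀ hs]
    have : (K : ℝ) ^ (r + 1) ≤ t ^ (r + 1) := by gcongr
    calc (K : ℝ) ^ r * (K * E) = K ^ (r + 1) * E := by ring
      _ ≤ t ^ (r + 1) * E := by gcongr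
      _ ≤ _ := by linarith
  have hζ2 : Fintype.card ι * (2 ^ (r + 1) * ζ ^ 2) ≤ K := by
    rw [hζdef, div_pow, mul_pow, ← mul_div_assoc, ← mul_div_assoc, div_le_iff₀ (by positivity)]
    calc (Fintype.card ι : ℝ) * (2 ^ (r + 1) * (K ^ 2 * E ^ 2))
        = K * (Fintype.card ι * 2 ^ (r + 1) * K * E ^ 2) := by ring
      _ ≤ K * (Fintype.card ι * 2 ^ (r + 1) * t * E ^ 2) := by gcongr
      _ ≤ K * s ^ 2 := by gcongr
  -- The vanishing of `b 1` is where the centring enters: `G` has no linear term.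
  let b : ℕ → ℝ := fun j => if j = 0 then 1 else if j = 1 then 0 else
    B ^ j * (j.factorial : ℝ) ^ (r + 1)
  have hb : ∀ i, ∀ j ≤ K, |∫ ω, Z i ω ^ j ∂P| ≤ b j := by
    intro i j _
    match j with
    | 0 => simp [b]
    | 1 => simp [b, hmean i]
    | j + 2 => simpa [b] using hmom i (j + 2) (by omega)
  have hG : ∑ i ∈ Finset.range (K + 1), b i * z ^ i / i.factorial ≤
      Real.exp (2 ^ (r + 1) * ζ ^ 2) := by
    rw [show K + 1 = (K - 1) + 1 + 1 by omega, Finset.sum_range_succ', Finset.sum_range_succ']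
    have : ∑ i ∈ Finset.range (K - 1), b (i + 1 + 1) * z ^ (i + 1 + 1) / (i + 1 + 1).factorial =
        ∑ i ∈ Finset.range (K - 1), ((i + 2).factorial : ℝ) ^ r * ζ ^ (i + 2) := by
      refine Finset.sum_congr rfl fun i _ => ?_
      have hf : ((i + 2).factorial : ℝ) ≠ 0 := by exact_mod_cast Nat.factorial_ne_zero _
      simp only [b, hzdef, div_pow]
      rw [if_neg (by omega), if_neg (by omega)]
      field_simp
      exact pow_succ' _ _
    rw [this]
    have h := sum_factorial_pow_mul_pow_le hζ.le hζ1
    have h' := Real.add_one_le_exp (2 ^ (r + 1) * ζ ^ 2)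
    simp only [b]
    norm_num
    linarith
  have hGn : 0 ≤ ∑ i ∈ Finset.range (K + 1), b i * z ^ i / i.factorial :=
    Finset.sum_nonneg fun i _ => by
      have : 0 ≤ b i := by simp only [b]; split_ifs <;> positivity
      positivity
  have hM := abs_integral_sum_pow_le hindep hmeas hint hb hz Finset.univ K le_rfl
  have hbound : |∫ ω, (∑ i, Z i ω) ^ K ∂P| ≤ s ^ K * Real.exp (-K) := by
    calc _ ≤ (K.factorial : ℝ) * z⁻¹ ^ K * Real.exp (2 ^ (r + 1) * ζ ^ 2) ^ Fintype.card ι := by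
          refine hM.trans ?_
          rw [Finset.card_univ]
          gcongr
      _ ≤ (K : ℝ) ^ K * z⁻¹ ^ K * Real.exp K := by
          rw [← Real.exp_nat_mul]
          gcongr
          exact_mod_cast Nat.factorial_le_pow K
      _ = s ^ K * Real.exp (-K) := by
          have : (K : ℝ) * z⁻¹ = s * Real.exp (-2) := by
            rw [hzdef, hζdef, hE, Real.exp_neg]; field_simp
          rw [← mul_pow, this, mul_pow, ← Real.exp_nat_mul, mul_assoc, ← Real.exp_add]
          congr 2; ring
  have hS : MemLp (fun ω => ∑ i, Z i ω) K P := memLp_finsetSum _ fun i _ => hint i K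
  have hmk := mul_meas_ge_le_integral_of_nonneg (μ := P) (f := fun ω => |∑ i, Z i ω| ^ K)
    (ae_of_all _ fun ω => by positivity) (by simpa using hS.integrable_norm_pow') (s ^ K)
  simp_rw [hKe.pow_abs] at hmk
  have hsub : P.real {ω | s ≤ |∑ i, Z i ω|} ≤ P.real {ω | s ^ K ≤ (∑ i, Z i ω) ^ K} := by
    refine measureReal_mono fun ω (hω : s ≤ _) => ?_
    change s ^ K ≤ _
    rw [← hKe.pow_abs (∑ i, Z i ω)]
    exact pow_le_pow_left₀ hs.le hω K
  have h3 : P.real {ω | s ^ K ≤ (∑ i, Z i ω) ^ K} ≤ Real.exp (-K) := by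
    have := hmk.trans ((le_abs_self _).trans hbound)
    exact le_of_mul_le_mul_left this (by positivity)
  have h4 : Real.exp (-K) ≤ Real.exp (-(1 / 4) * t) := Real.exp_le_exp.2 (by linarith)
  linarith [Real.exp_pos (-(1 / 4) * t)]

/-! ### Level-`m` features -/

lemma oneVar_nonneg {d n : ℕ} (x : Fin (n + 1) → EuclideanSpace ℝ (Fin d)) : 0 ≤ oneVar x :=
  Finset.sum_nonneg fun _ _ => norm_nonneg _

lemma inner_levelFeature {d m n₁ n₂ : ℕ} {H : Type} [NormedAddCommGroup H]
    [InnerProductSpace ℝ H] (φ : Fin m → EuclideanSpace ℝ (Fin d) → H)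
    (x : Fin (n₁ + 1) → EuclideanSpace ℝ (Fin d)) (y : Fin (n₂ + 1) → EuclideanSpace ℝ (Fin d)) :
    inner ℝ (levelFeature φ x) (levelFeature φ y) =
      ∑ i ∈ increasingTuples m n₁, ∑ j ∈ increasingTuples m n₂,
        ∏ p, inner ℝ (φ p (x (i p).succ) - φ p (x (i p).castSucc))
          (φ p (y (j p).succ) - φ p (y (j p).castSucc)) := by
  unfold levelFeature
  rw [sum_inner]
  refine Finset.sum_congr rfl fun i _ => ?_
  rw [inner_sum]
  simp only [inner_elementaryTensor]

/-- Each increasing tuple has `m!` distinct rearrangements, and together these are distinct terms of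
the expansion of `(∑ i, a i) ^ m`. -/
theorem sum_increasingTuples_prod_le {m n : ℕ} {a : Fin n → ℝ} (ha : ∀ i, 0 ≤ a i) :
    ∑ i ∈ increasingTuples m n, ∏ p, a (i p) ≤ (∑ i, a i) ^ m / m.factorial := by
  classical
  rw [le_div_iff₀ (by positivity), mul_comm]
  have hinj : Set.InjOn (fun q : Equiv.Perm (Fin m) × (Fin m → Fin n) => q.2 ∘ q.1)
      ((Finset.univ ×ˢ increasingTuples m n : Finset (Equiv.Perm (Fin m) × (Fin m → Fin n))) :
        Set _) := by
    rintro ⟨σ, i⟩ hi ⟨τ, j⟩ hj h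
    have hi' : StrictMono i := by simpa [increasingTuples] using hi
    have hj' : StrictMono j := by simpa [increasingTuples] using hj
    have h : i ∘ σ = j ∘ τ := h
    have hij : i = j := by
      rw [← hi'.range_inj hj', ← σ.surjective.range_comp i, ← τ.surjective.range_comp j, h]
    subst hij
    exact Prod.ext (Equiv.ext fun p => hi'.injective (congrFun h p)) rfl
  calc (m.factorial : ℝ) * ∑ i ∈ increasingTuples m n, ∏ p, a (i p)
      = ∑ q ∈ (Finset.univ : Finset (Equiv.Perm (Fin m))) ×ˢ increasingTuples m n,
          ∏ p, a ((q.2 ∘ q.1) p) := by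
        rw [Finset.sum_product]
        simp only [Function.comp]
        simp_rw [fun (σ : Equiv.Perm (Fin m)) (i : Fin m → Fin n) =>
          Equiv.prod_comp σ fun p => a (i p)]
        simp [Fintype.card_perm]
    _ = ∑ g ∈ ((Finset.univ : Finset (Equiv.Perm (Fin m))) ×ˢ increasingTuples m n).image
          (fun q => q.2 ∘ q.1), ∏ p, a (g p) := by
        rw [Finset.sum_image hinj]
    _ ≤ ∑ g : Fin m → Fin n, ∏ p, a (g p) :=
        Finset.sum_le_sum_of_subset_of_nonneg (Finset.subset_univ _)
          fun g _ _ => Finset.prod_nonneg fun p _ => ha _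
    _ = _ := by
        rw [← Fintype.piFinset_univ, ← Finset.prod_univ_sum]
        simp

theorem abs_inner_levelFeature_le {d m n₁ n₂ : ℕ} {H : Type} [NormedAddCommGroup H]
    [InnerProductSpace ℝ H] {φ : Fin m → EuclideanSpace ℝ (Fin d) → H} {c : Fin m → ℝ}
    (hφ : ∀ p u v, ‖φ p u - φ p v‖ ≤ c p * ‖u - v‖)
    (x : Fin (n₁ + 1) → EuclideanSpace ℝ (Fin d)) (y : Fin (n₂ + 1) → EuclideanSpace ℝ (Fin d)) :
    |inner ℝ (levelFeature φ x) (levelFeature φ y)| ≤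
      (oneVar x * oneVar y) ^ m / (m.factorial : ℝ) ^ 2 * ∏ p, c p ^ 2 := by
  rw [inner_levelFeature]
  calc _ ≤ ∑ i ∈ increasingTuples m n₁, ∑ j ∈ increasingTuples m n₂,
        (∏ p, ‖x (i p).succ - x (i p).castSucc‖) * (∏ p, ‖y (j p).succ - y (j p).castSucc‖) *
          ∏ p, c p ^ 2 := by
        refine (Finset.abs_sum_le_sum_abs _ _).trans (Finset.sum_le_sum fun i _ => ?_)
        refine (Finset.abs_sum_le_sum_abs _ _).trans (Finset.sum_le_sum fun j _ => ?_)
        rw [Finset.abs_prod, ← Finset.prod_mul_distrib, ← Finset.prod_mul_distrib]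
        refine Finset.prod_le_prod (fun p _ => abs_nonneg _) fun p _ => ?_
        have h1 := hφ p (x (i p).succ) (x (i p).castSucc)
        have h2 := hφ p (y (j p).succ) (y (j p).castSucc)
        calc _ ≤ _ := abs_real_inner_le_norm _ _
          _ ≤ _ := mul_le_mul h1 h2 (norm_nonneg _) ((norm_nonneg _).trans h1)
          _ = _ := by ring
    _ = (∑ i ∈ increasingTuples m n₁, ∏ p, ‖x (i p).succ - x (i p).castSucc‖) *
          (∑ j ∈ increasingTuples m n₂, ∏ p, ‖y (j p).succ - y (j p).castSucc‖) *
          ∏ p, c p ^ 2 := by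
        rw [Finset.sum_mul_sum, Finset.sum_mul]
        simp_rw [Finset.sum_mul]
    _ ≤ (oneVar x ^ m / m.factorial) * (oneVar y ^ m / m.factorial) * ∏ p, c p ^ 2 := by
        have hx := sum_increasingTuples_prod_le (m := m)
          (a := fun i : Fin n₁ => ‖x i.succ - x i.castSucc‖) fun i => norm_nonneg _
        have hy := sum_increasingTuples_prod_le (m := m)
          (a := fun i : Fin n₂ => ‖y i.succ - y i.castSucc‖) fun i => norm_nonneg _
        refine mul_le_mul_of_nonneg_right (mul_le_mul hx hy ?_ ?_)
          (Finset.prod_nonneg fun p _ => sq_nonneg (c p))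
        · exact Finset.sum_nonneg fun j _ => Finset.prod_nonneg fun p _ => norm_nonneg _
        · exact div_nonneg (pow_nonneg (oneVar_nonneg x) _) (Nat.cast_nonneg _)
    _ = _ := by rw [mul_pow]; ring

/-! ### Random Fourier features -/

lemma inner_fourierFeature {d : ℕ} (w u v : EuclideanSpace ℝ (Fin d)) :
    inner ℝ (fourierFeature w u) (fourierFeature w v) = Real.cos (inner ℝ w (u - v)) := by
  simp only [fourierFeature, PiLp.inner_apply, Fin.sum_univ_two, inner_sub_right, Real.cos_sub]
  simp
  ring

lemma inner_fourierFeature_sub {d : ℕ} (w u u' v v' : EuclideanSpace ℝ (Fin d)) :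
    inner ℝ (fourierFeature w u - fourierFeature w u') (fourierFeature w v - fourierFeature w v') =
      Real.cos (inner ℝ w (u - v)) - Real.cos (inner ℝ w (u - v')) -
        (Real.cos (inner ℝ w (u' - v)) - Real.cos (inner ℝ w (u' - v'))) := by
  rw [inner_sub_left, inner_sub_right (fourierFeature w u), inner_sub_right (fourierFeature w u')]
  simp only [inner_fourierFeature]

lemma norm_fourierFeature_sub_le {d : ℕ} (w u v : EuclideanSpace ℝ (Fin d)) :
    ‖fourierFeature w u - fourierFeature w v‖ ≤ ‖w‖ * ‖u - v‖ := by
  refine abs_le_of_sq_le_sq' ?_ (by positivity) |>.2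
  rw [← real_inner_self_eq_norm_sq, inner_fourierFeature_sub, ← neg_sub u v, inner_neg_right,
    Real.cos_neg, sub_self, sub_self, inner_zero_right, Real.cos_zero]
  have h1 := Real.one_sub_sq_div_two_le_cos (x := inner ℝ w (u - v))
  have h2 : (inner ℝ w (u - v)) ^ 2 ≤ (‖w‖ * ‖u - v‖) ^ 2 :=
    sq_le_sq' (neg_le_of_abs_le (abs_real_inner_le_norm _ _)) (real_inner_le_norm _ _)
  linarith

/-- The signature kernel of the Fourier features with one weight per tensor factor; the RFSF-DP
kernel is the average of `D` independent copies of it. -/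
noncomputable def fourierSigKernel {d m n₁ n₂ : ℕ}
    (x : Fin (n₁ + 1) → EuclideanSpace ℝ (Fin d)) (y : Fin (n₂ + 1) → EuclideanSpace ℝ (Fin d))
    (w : Fin m → EuclideanSpace ℝ (Fin d)) : ℝ :=
  inner ℝ (levelFeature (fun p => fourierFeature (w p)) x)
    (levelFeature (fun p => fourierFeature (w p)) y)

lemma dpKernel_eq_average {d m D n₁ n₂ : ℕ} (W : Fin m → Fin D → EuclideanSpace ℝ (Fin d))
    (x : Fin (n₁ + 1) → EuclideanSpace ℝ (Fin d)) (y : Fin (n₂ + 1) → EuclideanSpace ℝ (Fin d)) :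
    dpKernel W x y = (D : ℝ)⁻¹ * ∑ q, fourierSigKernel x y fun p => W p q := by
  rw [dpKernel, dpFeature, dpFeature, real_inner_smul_left, real_inner_smul_right, ← mul_assoc,
    one_div, ← mul_inv, Real.mul_self_sqrt (Nat.cast_nonneg D), PiLp.inner_apply]
  rfl

lemma abs_fourierSigKernel_le {d m n₁ n₂ : ℕ}
    (x : Fin (n₁ + 1) → EuclideanSpace ℝ (Fin d)) (y : Fin (n₂ + 1) → EuclideanSpace ℝ (Fin d))
    (w : Fin m → EuclideanSpace ℝ (Fin d)) :
    |fourierSigKernel x y w| ≤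
      (oneVar x * oneVar y) ^ m / (m.factorial : ℝ) ^ 2 * ∏ p, ‖w p‖ ^ 2 :=
  abs_inner_levelFeature_le (fun p => norm_fourierFeature_sub_le (w p)) x y

lemma continuous_fourierSigKernel {d m n₁ n₂ : ℕ}
    (x : Fin (n₁ + 1) → EuclideanSpace ℝ (Fin d)) (y : Fin (n₂ + 1) → EuclideanSpace ℝ (Fin d)) :
    Continuous (fourierSigKernel (m := m) x y) := by
  unfold fourierSigKernel
  simp_rw [inner_levelFeature, inner_fourierFeature_sub]
  fun_prop

/-! ### The spectral representation of the kernel -/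

section Spectral

variable {d : ℕ} {κ : EuclideanSpace ℝ (Fin d) → EuclideanSpace ℝ (Fin d) → ℝ}
  {Λ : Measure (EuclideanSpace ℝ (Fin d))}

lemma integrable_cos_inner [IsFiniteMeasure Λ] (u : EuclideanSpace ℝ (Fin d)) :
    Integrable (fun w => Real.cos (inner ℝ w u)) Λ :=
  .of_bound (by fun_prop) 1 (ae_of_all _ fun w => Real.abs_cos_le_one _)

lemma IsSpectralMeasure.integral_cos [IsFiniteMeasure Λ] (hΛ : IsSpectralMeasure κ Λ)
    (u v : EuclideanSpace ℝ (Fin d)) : ∫ w, Real.cos (inner ℝ w (u - v)) ∂Λ = κ u v := by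
  have h := congrArg Complex.re (hΛ u v)
  rw [← RCLike.re_eq_complex_re, ← integral_re] at h
  · simp only [RCLike.re_eq_complex_re, Complex.ofReal_re, mul_comm Complex.I,
      Complex.exp_ofReal_mul_I_re] at h
    exact h.symm
  · refine .of_bound (by fun_prop) 1 (ae_of_all _ fun w => ?_)
    rw [mul_comm, Complex.norm_exp_ofReal_mul_I]

variable {H : Type} [NormedAddCommGroup H] [InnerProductSpace ℝ H] [CompleteSpace H]
  [RKHS ℝ H (EuclideanSpace ℝ (Fin d)) ℝ]

lemma inner_kernelLift (u v : EuclideanSpace ℝ (Fin d)) :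
    inner ℝ (kernelLift H u) (kernelLift H v) = RKHS.kernel H u v (1 : ℝ) := by
  rw [real_inner_comm, kernelLift, kernelLift, ← RKHS.kernel_inner]
  simp

lemma integrable_inner_fourierFeature_sub [IsFiniteMeasure Λ]
    (u u' v v' : EuclideanSpace ℝ (Fin d)) :
    Integrable (fun w => inner ℝ (fourierFeature w u - fourierFeature w u')
      (fourierFeature w v - fourierFeature w v')) Λ := by
  simp_rw [inner_fourierFeature_sub]
  exact ((integrable_cos_inner _).sub (integrable_cos_inner _)).sub
    ((integrable_cos_inner _).sub (integrable_cos_inner _))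

theorem integral_inner_fourierFeature_sub [IsFiniteMeasure Λ]
    (hκ : ∀ u v, RKHS.kernel H u v (1 : ℝ) = κ u v) (hΛ : IsSpectralMeasure κ Λ)
    (u u' v v' : EuclideanSpace ℝ (Fin d)) :
    ∫ w, inner ℝ (fourierFeature w u - fourierFeature w u')
      (fourierFeature w v - fourierFeature w v') ∂Λ =
    inner ℝ (kernelLift H u - kernelLift H u') (kernelLift H v - kernelLift H v') := by
  simp_rw [inner_fourierFeature_sub]
  rw [integral_sub, integral_sub, integral_sub]
  · rw [inner_sub_left, inner_sub_right (kernelLift H u), inner_sub_right (kernelLift H u')]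
    simp only [inner_kernelLift, hκ, hΛ.integral_cos]
  all_goals first
    | exact integrable_cos_inner _
    | exact (integrable_cos_inner _).sub (integrable_cos_inner _)

/-- The RFSF-DP kernel is an unbiased estimator of the signature kernel. -/
theorem integral_fourierSigKernel [IsProbabilityMeasure Λ]
    (hκ : ∀ u v, RKHS.kernel H u v (1 : ℝ) = κ u v) (hΛ : IsSpectralMeasure κ Λ) {m n₁ n₂ : ℕ}
    (x : Fin (n₁ + 1) → EuclideanSpace ℝ (Fin d)) (y : Fin (n₂ + 1) → EuclideanSpace ℝ (Fin d)) :
    ∫ w, fourierSigKernel x y w ∂(Measure.pi fun _ : Fin m => Λ) = sigKernel H m x y := by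
  simp_rw [fourierSigKernel, sigKernel, inner_levelFeature]
  have hint (i : Fin m → Fin n₁) (j : Fin m → Fin n₂) :=
    Integrable.fintype_prod (μ := fun _ : Fin m => Λ) fun p =>
      integrable_inner_fourierFeature_sub (Λ := Λ) (x (i p).succ) (x (i p).castSucc)
        (y (j p).succ) (y (j p).castSucc)
  rw [integral_finsetSum _ fun i _ => integrable_finsetSum _ fun j _ => hint i j]
  refine Finset.sum_congr rfl fun i _ => ?_
  rw [integral_finsetSum _ fun j _ => hint i j]
  refine Finset.sum_congr rfl fun j _ => ?_
  rw [integral_fintype_prod_eq_prod (μ := fun _ : Fin m => Λ) fun p w =>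
    inner ℝ (fourierFeature w (x (i p).succ) - fourierFeature w (x (i p).castSucc))
      (fourierFeature w (y (j p).succ) - fourierFeature w (y (j p).castSucc))]
  simp_rw [integral_inner_fourierFeature_sub hκ hΛ]

/-! ### Moments of the spectral measure -/

variable {S R : ℝ}

lemma abs_coord_sq_le_add {S : ℝ} (hS : 0 < S) (a : ℝ) : |a| ^ 2 ≤ (S + |a| ^ 4 / S) / 2 := by
  have h : (|a| ^ 2 - S) ^ 2 / S = |a| ^ 4 / S - 2 * |a| ^ 2 + S := by field_simp; ring
  have : 0 ≤ (|a| ^ 2 - S) ^ 2 / S := by positivity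
  linarith

/-- The Bernstein condition in the shape used here; the second moments, which it does not
mention, are controlled by the fourth ones. -/
lemma BernsteinMoments.coord [IsProbabilityMeasure Λ] (h : BernsteinMoments Λ S R) (hS : 0 < S)
    (hR : 0 < R) (i : Fin d) (j : ℕ) :
    Integrable (fun w => |w i| ^ (2 * j)) Λ ∧
      ∫ w, |w i| ^ (2 * j) ∂Λ ≤ j.factorial * max S R ^ j := by
  match j with
  | 0 => simp
  | 1 =>
    have h4 := h i 2 le_rfl
    have hI : Integrable (fun w => (S + |w i| ^ (2 * 2) / S) / 2) Λ :=
      ((integrable_const S).add (h4.1.div_const S)).div_const 2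
    have hle : ∀ w : EuclideanSpace ℝ (Fin d), |w i| ^ (2 * 1) ≤ (S + |w i| ^ (2 * 2) / S) / 2 :=
      fun w => abs_coord_sq_le_add hS (w i)
    have hi : Integrable (fun w => |w i| ^ (2 * 1)) Λ := by
      refine hI.mono' (by fun_prop) (ae_of_all _ fun w => ?_)
      rw [Real.norm_of_nonneg (by positivity)]
      exact hle w
    refine ⟨hi, (integral_mono hi hI hle).trans ?_⟩
    rw [integral_div, integral_add (integrable_const S) (h4.1.div_const S), integral_div]
    have : (∫ w, |w i| ^ (2 * 2) ∂Λ) / S ≤ S := by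
      rw [div_le_iff₀ hS]
      refine h4.2.trans (le_of_eq ?_)
      norm_num [Nat.factorial]
      ring
    have hM := le_max_left S R
    simp only [integral_const, probReal_univ, smul_eq_mul, one_mul, Nat.factorial_one,
      Nat.cast_one, pow_one]
    linarith
  | j + 2 =>
    obtain ⟨h1, h2⟩ := h i (j + 2) (by omega)
    rw [Nat.add_sub_cancel] at h2
    refine ⟨h1, h2.trans ?_⟩
    have h0 : 0 ≤ max S R := hS.le.trans (le_max_left S R)
    calc ((j + 2).factorial : ℝ) * S ^ 2 * R ^ j / 2
        ≤ (j + 2).factorial * S ^ 2 * R ^ j := half_le_self (by positivity)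
      _ ≤ (j + 2).factorial * max S R ^ 2 * max S R ^ j := by
          gcongr
          · exact le_max_left S R
          · exact le_max_right S R
      _ = _ := by ring

theorem BernsteinMoments.norm [IsProbabilityMeasure Λ] (h : BernsteinMoments Λ S R) (hS : 0 < S)
    (hR : 0 < R) (j : ℕ) :
    Integrable (fun w => (‖w‖ ^ 2) ^ j) Λ ∧
      ∫ w, (‖w‖ ^ 2) ^ j ∂Λ ≤ j.factorial * (d * max S R) ^ j := by
  match j with
  | 0 => simp
  | j + 1 =>
    have hle (w : EuclideanSpace ℝ (Fin d)) :
        (‖w‖ ^ 2) ^ (j + 1) ≤ (d : ℝ) ^ j * ∑ i, |w i| ^ (2 * (j + 1)) := by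
      rw [EuclideanSpace.real_norm_sq_eq]
      have := pow_sum_le_card_mul_sum_pow (s := Finset.univ) (f := fun i => w i ^ 2)
        (fun i _ => sq_nonneg _) j
      simpa [pow_mul] using this
    have hI : Integrable (fun w : EuclideanSpace ℝ (Fin d) =>
        (d : ℝ) ^ j * ∑ i, |w i| ^ (2 * (j + 1))) Λ :=
      (integrable_finsetSum _ fun i _ => (h.coord hS hR i (j + 1)).1).const_mul _
    have hi : Integrable (fun w => (‖w‖ ^ 2) ^ (j + 1)) Λ := by
      refine hI.mono' (by fun_prop) (ae_of_all _ fun w => ?_)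
      rw [Real.norm_of_nonneg (by positivity)]
      exact hle w
    refine ⟨hi, (integral_mono hi hI hle).trans ?_⟩
    rw [integral_const_mul, integral_finsetSum _ fun i _ => (h.coord hS hR i (j + 1)).1]
    calc _ ≤ (d : ℝ) ^ j * ∑ i : Fin d, ((j + 1).factorial * max S R ^ (j + 1)) := by
          gcongr with i
          exact (h.coord hS hR i (j + 1)).2
      _ = _ := by simp; ring

/-! ### The Lipschitz constant of the kernel lift -/

/-- `E[(wᵀu)²] = uᵀ E[w wᵀ] u` is at most the spectral norm of `E[w wᵀ]` times `‖u‖²`. -/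
theorem integral_inner_sq_le [IsProbabilityMeasure Λ] (h : BernsteinMoments Λ S R) (hS : 0 < S)
    (hR : 0 < R) (u : EuclideanSpace ℝ (Fin d)) :
    Integrable (fun w => (inner ℝ w u) ^ 2) Λ ∧
      ∫ w, (inner ℝ w u) ^ 2 ∂Λ ≤ (spectralLipschitz Λ * ‖u‖) ^ 2 := by
  have hL2 (i : Fin d) : MemLp (fun w : EuclideanSpace ℝ (Fin d) => w i) 2 Λ := by
    have := (h.coord hS hR i 1).1
    exact (memLp_two_iff_integrable_sq (by fun_prop)).2 (by simpa using this)
  have hij (i j : Fin d) : Integrable (fun w : EuclideanSpace ℝ (Fin d) => w i * w j) Λ :=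
    (hL2 i).integrable_mul (hL2 j)
  have hexp (w : EuclideanSpace ℝ (Fin d)) :
      (inner ℝ w u) ^ 2 = ∑ i, ∑ j, u i * u j * (w i * w j) := by
    simp only [PiLp.inner_apply, RCLike.inner_apply, conj_trivial, sq, Finset.sum_mul_sum]
    exact Finset.sum_congr rfl fun i _ => Finset.sum_congr rfl fun j _ => by ring
  have hint (i j : Fin d) := (hij i j).const_mul (u i * u j)
  simp_rw [hexp]
  refine ⟨integrable_finsetSum _ fun i _ => integrable_finsetSum _ fun j _ => hint i j, ?_⟩
  rw [integral_finsetSum _ fun i _ => integrable_finsetSum _ fun j _ => hint i j]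
  simp_rw [integral_finsetSum _ fun j _ => hint _ j, integral_const_mul]
  set A := Matrix.toEuclideanCLM (n := Fin d) (𝕜 := ℝ) (secondMomentMatrix Λ) with hA
  have hq : ∑ i, ∑ j, u i * u j * ∫ w, w i * w j ∂Λ = inner ℝ (A u) u := by
    simp only [PiLp.inner_apply, RCLike.inner_apply, conj_trivial, hA,
      Matrix.ofLp_toEuclideanCLM, Matrix.mulVec, dotProduct, secondMomentMatrix, Matrix.of_apply,
      Finset.mul_sum]
    exact Finset.sum_congr rfl fun i _ => Finset.sum_congr rfl fun j _ => by ring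
  rw [hq, mul_pow, spectralLipschitz, Real.sq_sqrt (norm_nonneg _)]
  calc inner ℝ (A u) u ≤ ‖A u‖ * ‖u‖ := real_inner_le_norm _ _
    _ ≤ ‖A‖ * ‖u‖ * ‖u‖ := by gcongr; exact A.le_opNorm u
    _ = _ := by ring

theorem norm_kernelLift_sub_le [IsProbabilityMeasure Λ]
    (hκ : ∀ u v, RKHS.kernel H u v (1 : ℝ) = κ u v) (hΛ : IsSpectralMeasure κ Λ)
    (h : BernsteinMoments Λ S R) (hS : 0 < S) (hR : 0 < R) (u v : EuclideanSpace ℝ (Fin d)) :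
    ‖kernelLift H u - kernelLift H v‖ ≤ spectralLipschitz Λ * ‖u - v‖ := by
  refine abs_le_of_sq_le_sq' ?_
    (mul_nonneg (Real.sqrt_nonneg _) (norm_nonneg _)) |>.2
  obtain ⟨h1, h2⟩ := integral_inner_sq_le h hS hR (u - v)
  rw [← real_inner_self_eq_norm_sq, ← integral_inner_fourierFeature_sub hκ hΛ]
  refine (integral_mono (integrable_inner_fourierFeature_sub _ _ _ _) h1 fun w => ?_).trans h2
  simp only [inner_fourierFeature_sub]
  rw [← neg_sub u v, inner_neg_right, Real.cos_neg, sub_self, sub_self, inner_zero_right,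
    Real.cos_zero]
  have := Real.one_sub_sq_div_two_le_cos (x := inner ℝ w (u - v))
  linarith

end Spectral

/-! ### Moments of one block -/

section Block

variable {d : ℕ} {κ : EuclideanSpace ℝ (Fin d) → EuclideanSpace ℝ (Fin d) → ℝ}
  {Λ : Measure (EuclideanSpace ℝ (Fin d))} {S R : ℝ}

theorem BernsteinMoments.prod_norm [IsProbabilityMeasure Λ] (h : BernsteinMoments Λ S R)
    (hS : 0 < S) (hR : 0 < R) (m j : ℕ) :
    Integrable (fun w : Fin m → EuclideanSpace ℝ (Fin d) => (∏ p, ‖w p‖ ^ 2) ^ j)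
        (Measure.pi fun _ => Λ) ∧
      ∫ w : Fin m → EuclideanSpace ℝ (Fin d), (∏ p, ‖w p‖ ^ 2) ^ j ∂(Measure.pi fun _ => Λ) ≤
        ((d * max S R) ^ m) ^ j * (j.factorial : ℝ) ^ m := by
  obtain ⟨h1, h2⟩ := h.norm hS hR j
  simp_rw [← Finset.prod_pow]
  refine ⟨Integrable.fintype_prod (μ := fun _ : Fin m => Λ)
    (f := fun _ w => (‖w‖ ^ 2) ^ j) fun _ => h1, ?_⟩
  rw [integral_fintype_prod_eq_prod (μ := fun _ : Fin m => Λ) fun _ w => (‖w‖ ^ 2) ^ j]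
  rw [Finset.prod_const, Finset.card_univ, Fintype.card_fin]
  calc _ ≤ (j.factorial * (d * max S R) ^ j) ^ m :=
        pow_le_pow_left₀ (integral_nonneg fun w => by positivity) h2 m
    _ = _ := by ring

variable {H : Type} [NormedAddCommGroup H] [InnerProductSpace ℝ H] [CompleteSpace H]
  [RKHS ℝ H (EuclideanSpace ℝ (Fin d)) ℝ]

theorem abs_sigKernel_le [IsProbabilityMeasure Λ]
    (hκ : ∀ u v, RKHS.kernel H u v (1 : ℝ) = κ u v) (hΛ : IsSpectralMeasure κ Λ)
    (h : BernsteinMoments Λ S R) (hS : 0 < S) (hR : 0 < R) (m : ℕ) {n₁ n₂ : ℕ}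
    (x : Fin (n₁ + 1) → EuclideanSpace ℝ (Fin d)) (y : Fin (n₂ + 1) → EuclideanSpace ℝ (Fin d)) :
    |sigKernel H m x y| ≤
      (oneVar x * oneVar y) ^ m / (m.factorial : ℝ) ^ 2 * (d * max S R) ^ m := by
  obtain ⟨h1, h2⟩ := h.prod_norm hS hR m 1
  simp only [pow_one, Nat.factorial_one, Nat.cast_one, one_pow, mul_one] at h1 h2
  have hV : 0 ≤ oneVar x * oneVar y := mul_nonneg (oneVar_nonneg x) (oneVar_nonneg y)
  rw [← integral_fourierSigKernel hκ hΛ]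
  refine (norm_integral_le_of_norm_le (f := fun w : Fin m → _ => fourierSigKernel x y w)
    (h1.const_mul _) (ae_of_all _ fun w => abs_fourierSigKernel_le x y w)).trans ?_
  rw [integral_const_mul]
  gcongr

/-- The moments of one centred block, in the form that `measureReal_abs_sum_ge_le` needs. -/
theorem integral_abs_fourierSigKernel_sub_pow_le [IsProbabilityMeasure Λ]
    (hκ : ∀ u v, RKHS.kernel H u v (1 : ℝ) = κ u v) (hΛ : IsSpectralMeasure κ Λ)
    (h : BernsteinMoments Λ S R) (hS : 0 < S) (hR : 0 < R) (m : ℕ) {n₁ n₂ : ℕ}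
    (x : Fin (n₁ + 1) → EuclideanSpace ℝ (Fin d)) (y : Fin (n₂ + 1) → EuclideanSpace ℝ (Fin d))
    (j : ℕ) :
    Integrable (fun w : Fin m → EuclideanSpace ℝ (Fin d) =>
        |fourierSigKernel x y w - sigKernel H m x y| ^ j) (Measure.pi fun _ => Λ) ∧
      ∫ w : Fin m → EuclideanSpace ℝ (Fin d),
        |fourierSigKernel x y w - sigKernel H m x y| ^ j ∂(Measure.pi fun _ => Λ) ≤
        (2 * ((oneVar x * oneVar y) ^ m / (m.factorial : ℝ) ^ 2 * (d * max S R) ^ m)) ^ j *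
          (j.factorial : ℝ) ^ m := by
  obtain ⟨h1, h2⟩ := h.prod_norm hS hR m j
  have hsig := abs_sigKernel_le (H := H) hκ hΛ h hS hR m x y
  have hV : 0 ≤ oneVar x * oneVar y := mul_nonneg (oneVar_nonneg x) (oneVar_nonneg y)
  have hM : 0 ≤ max S R := hS.le.trans (le_max_left S R)
  set a := (oneVar x * oneVar y) ^ m / (m.factorial : ℝ) ^ 2
  have ha : 0 ≤ a := by positivity
  set N := (d * max S R : ℝ) ^ m
  have hN : 0 ≤ N := by positivity
  have hle (w : Fin m → EuclideanSpace ℝ (Fin d)) :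
      |fourierSigKernel x y w - sigKernel H m x y| ^ j ≤
        2 ^ (j - 1) * (a ^ j * (∏ p, ‖w p‖ ^ 2) ^ j + (a * N) ^ j) := by
    have hX : 0 ≤ ∏ p, ‖w p‖ ^ 2 := Finset.prod_nonneg fun p _ => sq_nonneg ‖w p‖
    calc _ ≤ (a * ∏ p, ‖w p‖ ^ 2 + a * N) ^ j := by
          gcongr
          exact (abs_sub _ _).trans (add_le_add (abs_fourierSigKernel_le x y w) hsig)
      _ ≤ _ := by
          rw [← mul_pow]
          exact add_pow_le (by positivity) (by positivity) j
  have hI : Integrable (fun w : Fin m → EuclideanSpace ℝ (Fin d) =>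
      2 ^ (j - 1) * (a ^ j * (∏ p, ‖w p‖ ^ 2) ^ j + (a * N) ^ j)) (Measure.pi fun _ => Λ) :=
    ((h1.const_mul _).add (integrable_const _)).const_mul _
  have hi : Integrable (fun w : Fin m → EuclideanSpace ℝ (Fin d) =>
      |fourierSigKernel x y w - sigKernel H m x y| ^ j) (Measure.pi fun _ => Λ) := by
    refine hI.mono' ?_ (ae_of_all _ fun w => ?_)
    · exact (((continuous_fourierSigKernel x y).sub continuous_const).abs.pow
        j).aestronglyMeasurable
    · rw [Real.norm_of_nonneg (by positivity)]
      exact hle w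
  refine ⟨hi, ?_⟩
  rcases Nat.eq_zero_or_pos j with rfl | hj
  · simp
  refine (integral_mono hi hI hle).trans ?_
  rw [integral_const_mul, integral_add (h1.const_mul _) (integrable_const _), integral_const_mul]
  simp only [integral_const, probReal_univ, smul_eq_mul, one_mul]
  have hf : (1 : ℝ) ≤ (j.factorial : ℝ) ^ m :=
    one_le_pow₀ (by exact_mod_cast Nat.one_le_iff_ne_zero.2 (Nat.factorial_ne_zero j))
  calc _ ≤ (2 : ℝ) ^ (j - 1) * (a ^ j * (N ^ j * (j.factorial : ℝ) ^ m) +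
        (a * N) ^ j * (j.factorial : ℝ) ^ m) := by
        gcongr
        exact le_mul_of_one_le_right (by positivity) hf
    _ = 2 ^ (j - 1 + 1) * (a * N) ^ j * (j.factorial : ℝ) ^ m := by ring
    _ = _ := by rw [Nat.sub_add_cancel hj, mul_pow 2 (a * N)]

end Block

/-! ### The joint law of the weights -/

/-- Under the joint law of all weights the `D` blocks of `m` weights are independent, so that the
concentration can be proved for the coordinates of a product measure. -/
theorem hasLaw_blocks {Ω E : Type*} [MeasurableSpace Ω] [MeasurableSpace E] {P : Measure Ω}
    {Λ : Measure E} [IsProbabilityMeasure Λ] {m D : ℕ} {w : Fin m → Fin D → Ω → E}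
    (hlaw : ∀ p q, HasLaw (w p q) Λ P)
    (hindep : iIndepFun (fun pq : Fin m × Fin D => w pq.1 pq.2) P) :
    HasLaw (fun ω (q : Fin D) (p : Fin m) => w p q ω)
      (Measure.pi fun _ : Fin D => Measure.pi fun _ : Fin m => Λ) P := by
  have h1 : HasLaw (fun ω (qp : Fin D × Fin m) => w qp.2 qp.1 ω)
      (Measure.infinitePi fun _ : Fin D × Fin m => Λ) P := by
    rw [Measure.infinitePi_eq_pi]
    exact (hindep.precomp (g := Prod.swap) Prod.swap_injective).hasLaw_pi
      (X := fun (qp : Fin D × Fin m) ω => w qp.2 qp.1 ω) fun qp => hlaw _ _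
  have h2 : HasLaw (MeasurableEquiv.curry (Fin D) (Fin m) E)
      (Measure.pi fun _ : Fin D => Measure.pi fun _ : Fin m => Λ)
      (Measure.infinitePi fun _ : Fin D × Fin m => Λ) := by
    refine ⟨by fun_prop, ?_⟩
    rw [Measure.infinitePi_map_curry fun _ _ => Λ]
    simp_rw [Measure.infinitePi_eq_pi]
  exact h2.comp h1

/-! ### Comparison of constants -/

lemma pow_self_le_exp_mul_factorial (m : ℕ) :
    (m : ℝ) ^ m ≤ Real.exp m * m.factorial := by
  have := Real.pow_div_factorial_le_exp (m : ℝ) (Nat.cast_nonneg m) m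
  rwa [div_le_iff₀ (by positivity)] at this

/-- The moment constant of one block, with the factors it acquires in the tail bound, is at most
`dpConstant`; the summand with `L` is not needed for this. -/
theorem two_pow_mul_le_dpConstant {d m : ℕ} (hm : 1 ≤ m) {V₁ V₂ S R : ℝ} (hV₁ : 0 ≤ V₁)
    (hV₂ : 0 ≤ V₂) (hS : 0 < S) (L : ℝ) :
    2 ^ m * (Real.exp 2 *
      (2 * ((V₁ * V₂) ^ m / (m.factorial : ℝ) ^ 2 * (d * max S R) ^ m))) ≤
      dpConstant d m V₁ V₂ S R L := by
  have hm0 : (0 : ℝ) < m := by exact_mod_cast hm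
  have hM : 0 ≤ max S R := hS.le.trans (le_max_left S R)
  have hlog : 0 < Real.log 2 := Real.log_pos one_lt_two
  have h8 : 1 ≤ √(8 : ℝ) := Real.one_le_sqrt.2 (by norm_num)
  have hπ : 1 ≤ (2 * Real.pi) ^ (1 / 4 : ℝ) :=
    Real.one_le_rpow (by linarith [Real.pi_gt_three]) (by norm_num)
  have he : 1 ≤ Real.exp (1 / 24) := Real.one_le_exp (by norm_num)
  have he2 : 2 ≤ Real.exp 2 := by linarith [Real.add_one_le_exp (2 : ℝ)]
  have he4 : 2 * Real.exp 2 ≤ Real.exp 4 := by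
    rw [show (4 : ℝ) = 2 + 2 by norm_num, Real.exp_add]; gcongr
  have hA : (V₁ * V₂) ^ m / (m.factorial : ℝ) ^ 2 ≤ (Real.exp 3 * V₁ * V₂ / m) ^ m := by
    have hf : (1 : ℝ) ≤ m.factorial := by
      exact_mod_cast Nat.one_le_iff_ne_zero.2 (Nat.factorial_ne_zero m)
    rw [div_pow, div_le_div_iff₀ (by positivity) (by positivity)]
    calc (V₁ * V₂) ^ m * (m : ℝ) ^ m ≤ (V₁ * V₂) ^ m * (Real.exp 3 ^ m * (m.factorial : ℝ) ^ 2) := by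
          gcongr
          calc (m : ℝ) ^ m ≤ Real.exp m * m.factorial := pow_self_le_exp_mul_factorial m
            _ ≤ Real.exp 3 ^ m * (m.factorial : ℝ) ^ 2 := by
              rw [← Real.exp_nat_mul]
              gcongr
              · linarith
              · exact le_self_pow₀ hf two_ne_zero
      _ = _ := by ring
  calc _ = 2 * Real.exp 2 * (2 ^ m * ((V₁ * V₂) ^ m / (m.factorial : ℝ) ^ 2) *
          (d * max S R) ^ m) := by ring
    _ ≤ Real.exp 4 * (4 ^ m * (Real.exp 3 * V₁ * V₂ / m) ^ m * (2 * (d * max S R)) ^ m) := by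
        have hdM : d * max S R ≤ 2 * (d * max S R) :=
          le_mul_of_one_le_left (by positivity) one_le_two
        have h24 : (2 : ℝ) ^ m ≤ 4 ^ m := by gcongr; norm_num
        gcongr
    _ = 1 * Real.exp 4 * 1 * 1 * (4 * Real.exp 3 * V₁ * V₂ / m) ^ m *
          ((2 * d * max S R) ^ m + 0) := by
        rw [← mul_pow]; ring
    _ ≤ _ := by
        unfold dpConstant
        gcongr
        positivity

theorem dpConstant_pos {d m : ℕ} (hm : 1 ≤ m) (hd : 0 < d) {V₁ V₂ S R : ℝ} (hV₁ : 0 < V₁)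
    (hV₂ : 0 < V₂) (hS : 0 < S) (L : ℝ) : 0 < dpConstant d m V₁ V₂ S R L := by
  have hM : 0 < max S R := hS.trans_le (le_max_left S R)
  have hm0 : (0 : ℝ) < m := by exact_mod_cast hm
  have hd0 : (0 : ℝ) < d := by exact_mod_cast hd
  refine lt_of_lt_of_le ?_ (two_pow_mul_le_dpConstant hm hV₁.le hV₂.le hS L)
  positivity

/-! ### Concentration of the averaged kernel -/

/-- In dimension zero every sequence is constant. -/
lemma pos_dim_of_oneVar_pos {d n : ℕ} {x : Fin (n + 1) → EuclideanSpace ℝ (Fin d)}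
    (hx : 0 < oneVar x) : 0 < d := by
  rcases Nat.eq_zero_or_pos d with rfl | hd
  · simp [oneVar, Subsingleton.elim _ (0 : EuclideanSpace ℝ (Fin 0))] at hx
  · exact hd

lemma levelFeature_eq_zero {d m n : ℕ} {H : Type} [NormedAddCommGroup H]
    [InnerProductSpace ℝ H] (hm : 1 ≤ m) (φ : Fin m → EuclideanSpace ℝ (Fin d) → H)
    {x : Fin (n + 1) → EuclideanSpace ℝ (Fin d)} (hx : oneVar x = 0) :
    levelFeature φ x = 0 := by
  have hinc (i : Fin n) : x i.succ = x i.castSucc := by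
    have := (Finset.sum_eq_zero_iff_of_nonneg fun i _ => norm_nonneg _).1 hx i (Finset.mem_univ i)
    exact sub_eq_zero.1 (norm_eq_zero.1 this)
  rw [← inner_self_eq_zero (𝕜 := ℝ), inner_levelFeature]
  refine Finset.sum_eq_zero fun i _ => Finset.sum_eq_zero fun j _ =>
    Finset.prod_eq_zero (Finset.mem_univ ⟨0, hm⟩) ?_
  rw [hinc, sub_self, inner_zero_left]

section Concentration

variable {d : ℕ} {κ : EuclideanSpace ℝ (Fin d) → EuclideanSpace ℝ (Fin d) → ℝ}
  {Λ : Measure (EuclideanSpace ℝ (Fin d))} {S R : ℝ}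
  {H : Type} [NormedAddCommGroup H] [InnerProductSpace ℝ H] [CompleteSpace H]
  [RKHS ℝ H (EuclideanSpace ℝ (Fin d)) ℝ]

/-- The deviation bound on the product space of the weights, with `t` the exponent and `s` the
deviation of the sum over the `D` blocks. -/
theorem measureReal_abs_sum_block_ge_le [IsProbabilityMeasure Λ]
    (hκ : ∀ u v, RKHS.kernel H u v (1 : ℝ) = κ u v) (hΛ : IsSpectralMeasure κ Λ)
    (h : BernsteinMoments Λ S R) (hS : 0 < S) (hR : 0 < R) {m : ℕ} (hm : 1 ≤ m) {n₁ n₂ : ℕ}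
    {x : Fin (n₁ + 1) → EuclideanSpace ℝ (Fin d)} {y : Fin (n₂ + 1) → EuclideanSpace ℝ (Fin d)}
    (hx : 0 < oneVar x) (hy : 0 < oneVar y) (L : ℝ) (D : ℕ) {s t : ℝ} (hs : 0 < s) (ht : 0 ≤ t)
    (h₁ : D * t * (2 * dpConstant d m (oneVar x) (oneVar y) S R L) ^ 2 ≤ s ^ 2)
    (h₂ : t ^ m * (√8 * dpConstant d m (oneVar x) (oneVar y) S R L) ≤ s) :
    (Measure.pi fun _ : Fin D => Measure.pi fun _ : Fin m => Λ).real
      {v | s ≤ |∑ q, (fourierSigKernel x y (v q) - sigKernel H m x y)|} ≤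
        2 * Real.exp (-(1 / 4) * t) := by
  have hd : (0 : ℝ) < d := by exact_mod_cast pos_dim_of_oneVar_pos hx
  have hM : 0 < max S R := hS.trans_le (le_max_left S R)
  have hC := dpConstant_pos (R := R) hm (pos_dim_of_oneVar_pos hx) hx hy hS L
  have hBC := two_pow_mul_le_dpConstant (d := d) (R := R) hm hx.le hy.le hS L
  set C := dpConstant d m (oneVar x) (oneVar y) S R L
  set B := 2 * ((oneVar x * oneVar y) ^ m / (m.factorial : ℝ) ^ 2 * (d * max S R) ^ m)
  have hB : 0 < B := by positivity
  set f : (Fin m → EuclideanSpace ℝ (Fin d)) → ℝ := fun w =>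
    fourierSigKernel x y w - sigKernel H m x y with hf
  have hfc : Continuous f := (continuous_fourierSigKernel x y).sub continuous_const
  set ν := Measure.pi fun _ : Fin m => Λ
  have hmom (j : ℕ) := integral_abs_fourierSigKernel_sub_pow_le (H := H) hκ hΛ h hS hR m x y j
  have hLp (j : ℕ) : MemLp f j ν := by
    rcases Nat.eq_zero_or_pos j with rfl | hj
    · simpa using hfc.aestronglyMeasurable
    · exact memLp_of_integrable_abs_pow hfc.aestronglyMeasurable hj.ne' (hmom j).1
  have hmp (q : Fin D) : MeasurePreserving (fun v : Fin D → _ => v q) (Measure.pi fun _ => ν) ν :=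
    measurePreserving_eval (fun _ => ν) q
  have hcomp (q : Fin D) (j : ℕ) :
      ∫ v : Fin D → _, f (v q) ^ j ∂(Measure.pi fun _ => ν) = ∫ w, f w ^ j ∂ν :=
    integral_comp_eval (μ := fun _ : Fin D => ν) (i := q) (f := fun w => f w ^ j)
      (hfc.pow j).aestronglyMeasurable
  have hmean : ∫ w, f w ∂ν = 0 := by
    have hk : Integrable (fun w => fourierSigKernel x y w) ν := by
      have := ((hLp 1).integrable (by simp)).add (integrable_const (sigKernel H m x y))
      exact this.congr (ae_of_all _ fun w => by simp [hf])
    rw [hf, integral_sub hk (integrable_const _), integral_fourierSigKernel hκ hΛ]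
    simp
  have hQC : Real.exp 2 * B ≤ 2 ^ m * (Real.exp 2 * B) :=
    le_mul_of_one_le_left (by positivity) (one_le_pow₀ (by norm_num))
  obtain ⟨r, rfl⟩ : ∃ r, m = r + 1 := ⟨m - 1, by omega⟩
  refine measureReal_abs_sum_ge_le (P := Measure.pi fun _ : Fin D => ν) (Z := fun q v => f (v q))
    (iIndepFun_pi (X := fun _ => f) fun _ => hfc.aemeasurable)
    (fun q => hfc.measurable.comp (measurable_pi_apply q))
    (fun q j => (hLp j).comp_measurePreserving (hmp q)) (fun q => ?_) hB (r := r)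
    (fun q j _ => ?_) hs ?_ ?_
  · simpa [hmean] using hcomp q 1
  · rw [hcomp q j]
    refine (abs_integral_le_integral_abs).trans ?_
    simp_rw [abs_pow]
    exact (hmom j).2
  · refine le_trans ?_ h₁
    rw [Fintype.card_fin]
    have : 2 ^ (r + 1) * (Real.exp 2 * B) ^ 2 ≤ (2 * C) ^ 2 := by
      calc 2 ^ (r + 1) * (Real.exp 2 * B) ^ 2
          = (2 ^ (r + 1) * (Real.exp 2 * B)) * (Real.exp 2 * B) := by ring
        _ ≤ C * C := by gcongr; exact hQC.trans hBC
        _ ≤ _ := by nlinarith [sq_nonneg C]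
    calc _ = D * t * (2 ^ (r + 1) * (Real.exp 2 * B) ^ 2) := by ring
      _ ≤ _ := by gcongr
  · refine le_trans ?_ h₂
    have h8 : 2 ≤ √(8 : ℝ) := Real.le_sqrt_of_sq_le (by norm_num)
    calc 2 * t ^ (r + 1) * (Real.exp 2 * B) = t ^ (r + 1) * (2 * (Real.exp 2 * B)) := by ring
      _ ≤ _ := by gcongr; exact hQC.trans hBC

end Concentration

theorem theorem2 {d : ℕ}
    (κ : EuclideanSpace ℝ (Fin d) → EuclideanSpace ℝ (Fin d) → ℝ)
    (H : Type) [NormedAddCommGroup H] [InnerProductSpace ℝ H] [CompleteSpace H]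
    [RKHS ℝ H (EuclideanSpace ℝ (Fin d)) ℝ]
    (hκ : ∀ u v, RKHS.kernel H u v (1 : ℝ) = κ u v)
    (Λ : Measure (EuclideanSpace ℝ (Fin d))) [IsProbabilityMeasure Λ]
    (hΛ : IsSpectralMeasure κ Λ)
    (S R : ℝ) (hS : 0 < S) (hR : 0 < R) (hmoment : BernsteinMoments Λ S R)
    (m : ℕ) (hm : 1 ≤ m) {n₁ n₂ : ℕ}
    (x : Fin (n₁ + 1) → EuclideanSpace ℝ (Fin d))
    (y : Fin (n₂ + 1) → EuclideanSpace ℝ (Fin d)) :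
    (∀ u v, ‖kernelLift H u - kernelLift H v‖ ≤ spectralLipschitz Λ * ‖u - v‖) ∧
    (0 < oneVar x → 0 < oneVar y →
      ∃ C : ℝ, 0 < C ∧
        C ≤ dpConstant d m (oneVar x) (oneVar y) S R (spectralLipschitz Λ) ∧
        ∀ (Ω : Type*) [MeasurableSpace Ω] (P : Measure Ω) [IsProbabilityMeasure P]
          (D : ℕ) (_ : 1 ≤ D) (w : Fin m → Fin D → Ω → EuclideanSpace ℝ (Fin d))
          (_ : ∀ p q, HasLaw (w p q) Λ P)
          (_ : iIndepFun (fun pq : Fin m × Fin D => w pq.1 pq.2) P)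
          (ε : ℝ) (_ : 0 < ε),
          P.real {ω | ε ≤ |dpKernel (fun p q => w p q ω) x y - sigKernel H m x y|} ≤
            2 * Real.exp (-(1 / 4) *
              min ((√(D : ℝ) * ε / (2 * C)) ^ 2) ((D * ε / (√8 * C)) ^ (1 / (m : ℝ))))) ∧
    (oneVar x = 0 ∨ oneVar y = 0 →
      ∀ (D : ℕ) (W : Fin m → Fin D → EuclideanSpace ℝ (Fin d)),
        dpKernel W x y = sigKernel H m x y) := by
  refine ⟨norm_kernelLift_sub_le hκ hΛ hmoment hS hR, fun hx hy => ?_, fun hxy D W => ?_⟩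
  · have hC := dpConstant_pos (R := R) hm (pos_dim_of_oneVar_pos hx) hx hy hS (spectralLipschitz Λ)
    refine ⟨dpConstant d m (oneVar x) (oneVar y) S R (spectralLipschitz Λ), hC, le_rfl, ?_⟩
    intro Ω _ P _ D hD w hlaw hindep ε hε
    set C := dpConstant d m (oneVar x) (oneVar y) S R (spectralLipschitz Λ)
    have hD0 : (0 : ℝ) < D := by exact_mod_cast hD
    set t := min ((√(D : ℝ) * ε / (2 * C)) ^ 2) ((D * ε / (√8 * C)) ^ (1 / (m : ℝ)))
    have ht0 : 0 ≤ t := le_min (by positivity) (by positivity)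
    have h₁ : D * t * (2 * C) ^ 2 ≤ (D * ε) ^ 2 := by
      have : t ≤ (√(D : ℝ) * ε / (2 * C)) ^ 2 := min_le_left _ _
      rw [div_pow, mul_pow, Real.sq_sqrt hD0.le, le_div_iff₀ (by positivity)] at this
      calc D * t * (2 * C) ^ 2 = D * (t * (2 * C) ^ 2) := by ring
        _ ≤ D * (D * ε ^ 2) := by gcongr
        _ = _ := by ring
    have h₂ : t ^ m * (√8 * C) ≤ D * ε := by
      rw [← le_div_iff₀ (by positivity)]
      calc t ^ m ≤ ((D * ε / (√8 * C)) ^ (1 / (m : ℝ))) ^ m := by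
            gcongr; exact min_le_right _ _
        _ = _ := by
            rw [one_div, Real.rpow_inv_natCast_pow (by positivity) (by omega)]
    have hset : {ω | ε ≤ |dpKernel (fun p q => w p q ω) x y - sigKernel H m x y|} =
        {ω | D * ε ≤ |∑ q, (fourierSigKernel x y (fun p => w p q ω) - sigKernel H m x y)|} := by
      ext ω
      have : dpKernel (fun p q => w p q ω) x y - sigKernel H m x y = (D : ℝ)⁻¹ *
          ∑ q, (fourierSigKernel x y (fun p => w p q ω) - sigKernel H m x y) := by
        rw [dpKernel_eq_average, Finset.sum_sub_distrib, mul_sub]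
        simp [hD0.ne']
      rw [Set.mem_ofPred_eq, Set.mem_ofPred_eq, this, abs_mul, abs_of_pos (inv_pos.2 hD0),
        le_inv_mul_iff₀ hD0]
    rw [hset, (hasLaw_blocks hlaw hindep).measureReal_eq
      (p := fun v => D * ε ≤ |∑ q, (fourierSigKernel x y (v q) - sigKernel H m x y)|)]
    · exact measureReal_abs_sum_block_ge_le hκ hΛ hmoment hS hR hm hx hy _ D (by positivity)
        ht0 h₁ h₂
    · have hc (q : Fin D) : Continuous fun v : Fin D → Fin m → EuclideanSpace ℝ (Fin d) =>
          fourierSigKernel x y (v q) :=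
        (continuous_fourierSigKernel x y).comp (continuous_apply q)
      exact measurableSet_le measurable_const
        (continuous_finsetSum _ fun q _ => (hc q).sub continuous_const).abs.measurable
  · rw [dpKernel_eq_average, sigKernel]
    simp only [fourierSigKernel]
    rcases hxy with h0 | h0
    · simp [levelFeature_eq_zero hm _ h0]
    · simp [levelFeature_eq_zero hm _ h0]
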